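/- **Setting.** Fix a first-order language $\mathscr{L}$: a collection of quantifier symbols and a collection of propositional connectives with finite arities, among them a designated constant $e$ and a designated binary symbol $\otimes$. An object $(\mathcal{C},P)$ of $\mathbf{FA}$ is a category $\mathcal{C}$ with designated finite products and a functor $P\colon \mathcal{C}^{op}\to\mathbf{Pos}$ together with: an algebra structure for the connectives on each fibre $P(c)$ (not assumed monotone) such that $(P(c),\otimes,e)$ is a monoid and each $P(f)$ is a homomorphism; elements $Eq_c\in P(c\times c)$; and, for each quantifier symbol $\Omega$, maps (not assumed monotone) $\Omega_{b,c}\colon P(b\times c)\to P(b)$ natural in $b$, such that $$\Omega_{b,1}\circ P(\pi_1^{b,1})=\mathrm{id},\qquad \Omega_{b,c\times d}\circ P(a_{b,c,d})=\Omega_{b,c}\circ\Omega_{b\times c,d},\qquad Eq_1=e_{1\times 1},$$ $$Eq_{c}=P(\langle \pi_1^{c_1,c_2}\pi_1^{c,c},\pi_1^{c_1,c_2}\pi_2^{c,c}\rangle)Eq_{c_1}\otimes P(\langle \pi_2^{c_1,c_2}\pi_1^{c,c},\pi_2^{c_1,c_2}\pi_2^{c,c}\rangle)Eq_{c_2}\quad\text{for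 } c=c_1\times c_2,$$ where $a_{b,c,d}\colon b\times(c\times d)\to(b\times c)\times d$ is the canonical isomorphism. A morphism $F\colon(\mathcal{C},P)\to(\mathcal{D},Q)$ of $\mathbf{FA}$ is a pair of a finite-product-preserving functor $F^o\colon\mathcal{C}\to\mathcal{D}$ and a natural transformation $F^p\colon P\Rightarrow Q F^o$ whose components are homomorphisms for the connectives and satisfy $$F^p_b\circ\Omega_{b,c}=\Omega_{F^ob,F^oc}\circ Q(a_{F,b,c}^{-1})\circ F^p_{b\times c},\qquad F^p_{c\times c}(Eq_c)=Q(a_{F,c,c})(Eq_{F^oc}),$$ where $a_{F,b,c}\colon F^o(b\times c)\to F^ob\times F^oc$ is the canonical isomorphism. Morphisms are composed componentwise. For a many-sorted signature $Sg$, assertions are equations-in-context between terms and sequents-in-context $\phi_1,\dots,\phi_n\vdash\psi\ [\Gamma]$ between first-order formulas over $\mathscr{L}$, and an $Sg$-theory is a set of assertions. Formulas are interpreted by $Sg$-structures in $(\mathcal{C},P)$ in the usual way (atomic formulas by reindexing along the interpretations of terms, connectives, equality and quantifiers by the corresponding operations of $(\mathcal{C},P)$). An equation is satisfied if the two interpretations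 are equal, and the sequent above is satisfied if $[\![\phi_1]\!]\otimes\cdots\otimes[\![\phi_n]\!]\le[\![\psi]\!]$ (with $e$ on the left if $n=0$). A logic $\mathcal{L}$ is a closure operator on the lattice of $Sg$-theories for each signature $Sg$. $\mathbf{FA}_{\mathcal{L}}$ is the full subcategory of $\mathbf{FA}$ on those $(\mathcal{C},P)$ in which $\mathcal{L}$ is sound: for all $Sg$-theories $T,T'$ with $T'$ contained in the $\mathcal{L}$-closure of $T$, every structure in $(\mathcal{C},P)$ satisfying $T$ satisfies $T'$. A morphism $\psi$ is a *subprop-morphism* if $\psi^o$ is faithful and every $\psi^p_c$ is an order embedding. The *kernel* $\ker F$ of $F\colon(\mathcal{C},P)\to(\mathcal{D},Q)$ consists of three relations: $c_1\sim c_2$ iff $F^oc_1=F^oc_2$ on objects of $\mathcal{C}$; $f_1\sim f_2$ iff $F^of_1=F^of_2$ on morphisms of $\mathcal{C}$; and, for $r_i\in P(c_i)$, $r_1\prec r_2$ iff $F^oc_1=F^oc_2$ and $F^p_{c_1}(r_1)\le F^p_{c_2}(r_2)$ in $Q(F^oc_1)$, on $\bigsqcup_c P(c)$. Write $\ker K\le\ker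 F$ if each relation of $\ker K$ is contained in the corresponding relation of $\ker F$. **Theorem (Fibered homomorphism theorem).** Let $\mathcal{L}$ be a logic and $F\colon(\mathcal{C},P)\to(\mathcal{D},Q)$ a morphism in $\mathbf{FA}_{\mathcal{L}}$. 1. There are an object $(\mathcal{E},R)$ of $\mathbf{FA}_{\mathcal{L}}$ and morphisms $\epsilon\colon(\mathcal{C},P)\to(\mathcal{E},R)$ and $\psi\colon(\mathcal{E},R)\to(\mathcal{D},Q)$ such that $F=\psi\circ\epsilon$, the functor $\epsilon^o$ is bijective on objects and full, $\epsilon^p_c$ is surjective for every object $c$ of $\mathcal{C}$, and $\psi$ is a subprop-morphism. 2. Let $K\colon(\mathcal{C},P)\to(\mathcal{E},R)$ be a morphism in $\mathbf{FA}_{\mathcal{L}}$ such that $K^o$ is full and surjective on objects and $K^p_c\colon P(c)\to R(K^oc)$ is surjective for every object $c$ of $\mathcal{C}$. Then there is a unique morphism $H\colon(\mathcal{E},R)\to(\mathcal{D},Q)$ with $H\circ K=F$ if and only if $\ker K\le\ker F$. -/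

import Mathlib

open CategoryTheory MonoidalCategory CartesianMonoidalCategory Opposite

universe l s u v w

namespace FibUA

/-! ### First-order languages, signatures, contexts, terms, formulas -/

/-- A first-order language: quantifier symbols and finitary propositional connectives, among the
latter a designated constant `e` and a designated binary symbol `tensor`. -/
structure FOLang where
  quant : Type l
  conn : ℕ → Type l
  e : conn 0
  tensor : conn 2

/-- Finite lists that grow on the right: `[x₁ : σ₁, …, xₙ : σₙ]`. A context is identified with the
list of its sorts, so that its variables are its positions. -/
inductive Ctx (S : Type s) : Type s
  | nil : Ctx S
  | snoc (Γ : Ctx S) (σ : S) : Ctx S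

/-- `Var Γ σ` is the type of variables (positions) of sort `σ` in the context `Γ`. -/
inductive Var {S : Type s} : Ctx S → S → Type s
  | here {Γ : Ctx S} {σ : S} : Var (Γ.snoc σ) σ
  | there {Γ : Ctx S} {σ τ : S} (x : Var Γ σ) : Var (Γ.snoc τ) σ

/-- A many-sorted signature: sorts, typed function symbols, typed relation symbols. -/
structure Signature where
  Srt : Type s
  Fn : Type s
  fnDom : Fn → Ctx Srt
  fnCod : Fn → Srt
  Rel : Type s
  relDom : Rel → Ctx Srt

/-- Terms-in-context `M : τ [Γ]`. -/
inductive Term (Sg : Signature.{s}) (Γ : Ctx Sg.Srt) : Sg.Srt → Type s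
  | var {σ : Sg.Srt} (x : Var Γ σ) : Term Sg Γ σ
  | app (f : Sg.Fn) (args : ∀ σ : Sg.Srt, Var (Sg.fnDom f) σ → Term Sg Γ σ) :
      Term Sg Γ (Sg.fnCod f)

/-- Formulas-in-context `φ : prop [Γ]`. A quantifier binds the last variable of the context. Since
variables are positions, formulas are automatically taken up to renaming of bound variables. -/
inductive Formula (L : FOLang.{l}) (Sg : Signature.{s}) : Ctx Sg.Srt → Type (max l s)
  | rel {Γ : Ctx Sg.Srt} (R : Sg.Rel)
      (args : ∀ σ : Sg.Srt, Var (Sg.relDom R) σ → Term Sg Γ σ) : Formula L Sg Γ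
  | eq {Γ : Ctx Sg.Srt} {σ : Sg.Srt} (M N : Term Sg Γ σ) : Formula L Sg Γ
  | conn {Γ : Ctx Sg.Srt} {n : ℕ} (k : L.conn n) (φ : Fin n → Formula L Sg Γ) : Formula L Sg Γ
  | quant {Γ : Ctx Sg.Srt} (q : L.quant) (σ : Sg.Srt) (φ : Formula L Sg (Γ.snoc σ)) :
      Formula L Sg Γ

/-- Assertions: equations-in-context and sequents-in-context `φ₁, …, φₙ ⊢ ψ [Γ]`. -/
inductive Assertion (L : FOLang.{l}) (Sg : Signature.{s}) : Type (max l s)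
  | eqn (Γ : Ctx Sg.Srt) (σ : Sg.Srt) (M N : Term Sg Γ σ) : Assertion L Sg
  | seq (Γ : Ctx Sg.Srt) (Φ : List (Formula L Sg Γ)) (ψ : Formula L Sg Γ) : Assertion L Sg

/-- An `Sg`-theory is a set of `Sg`-assertions; theories are ordered by inclusion. -/
abbrev Theory (L : FOLang.{l}) (Sg : Signature.{s}) : Type (max l s) := Set (Assertion L Sg)

/-- A first-order logic: a closure operator on the lattice of `Sg`-theories, for each `Sg`. -/
abbrev Logic (L : FOLang.{l}) : Type (max l (s + 1)) :=
  ∀ Sg : Signature.{s}, ClosureOperator (Theory L Sg)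

/-- `T ⊢ T'`: the theory `T'` is derivable from `T`. -/
def Logic.Derives {L : FOLang.{l}} (Λ : Logic.{l, s} L) {Sg : Signature.{s}}
    (T T' : Theory L Sg) : Prop :=
  T' ≤ Λ Sg T

/-! ### Prop-categories -/

/-- A prop-category `(𝒞, P)`: a category with designated finite products and a contravariant functor
from it to posets. -/
structure PropCat where
  C : Type u
  [cat : Category.{v} C]
  [prod : CartesianMonoidalCategory C]
  P : Cᵒᵖ ⥤ PartOrd.{w}

attribute [instance] PropCat.cat PropCat.prod

namespace PropCat

/-- The poset `P(c)`. -/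
abbrev Fib (X : PropCat.{u, v, w}) (c : X.C) : Type w := X.P.obj (op c)

/-- The monotone map `P(f) : P(d) → P(c)` for `f : c ⟶ d`. -/
def pull (X : PropCat.{u, v, w}) {c d : X.C} (f : c ⟶ d) (r : X.Fib d) : X.Fib c :=
  X.P.map f.op r

end PropCat

/-- The objects of `𝐅𝐀`: prop-categories whose fibres interpret connectives, equality and
quantifiers. No monotonicity of these operations is assumed. -/
structure FA (L : FOLang.{l}) extends PropCat.{u, v, w} where
  /-- every fibre is an algebra for the connectives -/
  conn {n : ℕ} (k : L.conn n) (c : C) (r : Fin n → toPropCat.Fib c) : toPropCat.Fib c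
  /-- the maps `P(f)` are homomorphisms of these algebras -/
  pull_conn {n : ℕ} (k : L.conn n) {c d : C} (f : c ⟶ d) (r : Fin n → toPropCat.Fib d) :
    toPropCat.pull f (conn k d r) = conn k c (fun i => toPropCat.pull f (r i))
  /-- the designated equality elements -/
  Eq (c : C) : toPropCat.Fib (c ⊗ c)
  /-- the quantifier maps `Ω_{b,c} : P(b × c) → P(b)` -/
  quant (q : L.quant) (b c : C) (r : toPropCat.Fib (b ⊗ c)) : toPropCat.Fib b
  /-- `Ω_{(·),c}` is natural -/
  pull_quant (q : L.quant) {b b' : C} (c : C) (f : b ⟶ b') (r : toPropCat.Fib (b' ⊗ c)) :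
    toPropCat.pull f (quant q b' c r) = quant q b c (toPropCat.pull (f ▷ c) r)
  /-- the interpretations of `tensor` and `e` make every fibre a monoid -/
  tensor_assoc (c : C) (r₁ r₂ r₃ : toPropCat.Fib c) :
    conn L.tensor c ![conn L.tensor c ![r₁, r₂], r₃] =
      conn L.tensor c ![r₁, conn L.tensor c ![r₂, r₃]]
  e_tensor (c : C) (r : toPropCat.Fib c) : conn L.tensor c ![conn L.e c ![], r] = r
  tensor_e (c : C) (r : toPropCat.Fib c) : conn L.tensor c ![r, conn L.e c ![]] = r
  /-- `Ω_{b,1} ∘ P(π₁) = id` -/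
  quant_unit (q : L.quant) (b : C) (r : toPropCat.Fib b) :
    quant q b (𝟙_ C) (toPropCat.pull (fst b (𝟙_ C)) r) = r
  /-- `Ω_{b,c×d} ∘ P(a) = Ω_{b,c} ∘ Ω_{b×c,d}` with `a : b × (c × d) ⟶ (b × c) × d` -/
  quant_prod (q : L.quant) (b c d : C) (r : toPropCat.Fib ((b ⊗ c) ⊗ d)) :
    quant q b (c ⊗ d) (toPropCat.pull (α_ b c d).inv r) = quant q b c (quant q (b ⊗ c) d r)
  Eq_unit : Eq (𝟙_ C) = conn L.e (𝟙_ C ⊗ 𝟙_ C) ![]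
  Eq_prod (c₁ c₂ : C) :
    Eq (c₁ ⊗ c₂) = conn L.tensor ((c₁ ⊗ c₂) ⊗ (c₁ ⊗ c₂))
      ![toPropCat.pull (lift (fst (c₁ ⊗ c₂) (c₁ ⊗ c₂) ≫ fst c₁ c₂)
          (snd (c₁ ⊗ c₂) (c₁ ⊗ c₂) ≫ fst c₁ c₂)) (Eq c₁),
        toPropCat.pull (lift (fst (c₁ ⊗ c₂) (c₁ ⊗ c₂) ≫ snd c₁ c₂)
          (snd (c₁ ⊗ c₂) (c₁ ⊗ c₂) ≫ snd c₁ c₂)) (Eq c₂)]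

/-! ### Structures, satisfaction, and the prop-categories that model a logic -/

section Products

variable {C : Type u} [Category.{v} C] [CartesianMonoidalCategory C] {S : Type s}

/-- The product `⟦σ₁⟧ × ⋯ × ⟦σₙ⟧`: the terminal object for `n = 0`, the object `⟦σ₁⟧` itself for
`n = 1`, and bracketed to the left for `n ≥ 2`. -/
def prodObj (I : S → C) : Ctx S → C
  | .nil => 𝟙_ C
  | .snoc .nil σ => I σ
  | .snoc (.snoc Γ τ) σ => prodObj I (Γ.snoc τ) ⊗ I σ

/-- The projections `πᵢ : ⟦σ₁⟧ × ⋯ × ⟦σₙ⟧ ⟶ ⟦σᵢ⟧`. -/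
def proj (I : S → C) : {Γ : Ctx S} → {σ : S} → Var Γ σ → (prodObj I Γ ⟶ I σ)
  | .snoc .nil _, _, .here => 𝟙 _
  | .snoc (.snoc Γ τ) σ, _, .here => snd (prodObj I (Γ.snoc τ)) (I σ)
  | .snoc (.snoc Γ τ) σ, _, .there x => fst (prodObj I (Γ.snoc τ)) (I σ) ≫ proj I x

/-- The morphism `⟨g₁, …, gₙ⟩ : A ⟶ ⟦σ₁⟧ × ⋯ × ⟦σₙ⟧`. -/
def tuple (I : S → C) {A : C} :
    (Γ : Ctx S) → (∀ σ : S, Var Γ σ → (A ⟶ I σ)) → (A ⟶ prodObj I Γ)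
  | .nil, _ => toUnit A
  | .snoc .nil σ, g => g σ .here
  | .snoc (.snoc Γ τ) σ, g => lift (tuple I (Γ.snoc τ) (fun ρ x => g ρ (.there x))) (g σ .here)

/-- The change-in-product isomorphism `⟦Γ⟧ × ⟦σ⟧ ⟶ ⟦Γ, x : σ⟧`. -/
def snocMap (I : S → C) (Γ : Ctx S) (σ : S) : prodObj I Γ ⊗ I σ ⟶ prodObj I (Γ.snoc σ) :=
  tuple I (Γ.snoc σ) (fun _ x => match x with
    | .here => snd (prodObj I Γ) (I σ)
    | .there y => fst (prodObj I Γ) (I σ) ≫ proj I y)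

end Products

/-- An `Sg`-structure in a prop-category. -/
structure Str {L : FOLang.{l}} (Sg : Signature.{s}) (X : FA.{l, u, v, w} L) where
  srt : Sg.Srt → X.C
  fn (f : Sg.Fn) : prodObj srt (Sg.fnDom f) ⟶ srt (Sg.fnCod f)
  rel (R : Sg.Rel) : X.Fib (prodObj srt (Sg.relDom R))

namespace Str

variable {L : FOLang.{l}} {Sg : Signature.{s}} {X : FA.{l, u, v, w} L}

/-- The interpretation of terms-in-context. -/
def term (A : Str Sg X) {Γ : Ctx Sg.Srt} :
    {τ : Sg.Srt} → Term Sg Γ τ → (prodObj A.srt Γ ⟶ A.srt τ)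
  | _, .var x => proj A.srt x
  | _, .app f args => tuple A.srt (Sg.fnDom f) (fun σ x => A.term (args σ x)) ≫ A.fn f

/-- The interpretation of formulas-in-context. -/
def formula (A : Str Sg X) : {Γ : Ctx Sg.Srt} → Formula L Sg Γ → X.Fib (prodObj A.srt Γ)
  | _, .rel R args => X.pull (tuple A.srt (Sg.relDom R) (fun σ x => A.term (args σ x))) (A.rel R)
  | _, .eq (σ := σ) M N => X.pull (lift (A.term M) (A.term N)) (X.Eq (A.srt σ))
  | Γ, .conn k φ => X.conn k (prodObj A.srt Γ) (fun i => A.formula (φ i))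
  | Γ, .quant q σ φ =>
      X.quant q (prodObj A.srt Γ) (A.srt σ) (X.pull (snocMap A.srt Γ σ) (A.formula φ))

/-- Satisfaction of an assertion. For a sequent, `⟦φ₁⟧ ⊗ ⋯ ⊗ ⟦φₙ⟧ ≤ ⟦ψ⟧`, where the empty product
is `e`. -/
def Sat (A : Str Sg X) : Assertion L Sg → Prop
  | .eqn _ _ M N => A.term M = A.term N
  | .seq Γ Φ ψ =>
      (Φ.map A.formula).foldr (fun r t => X.conn L.tensor (prodObj A.srt Γ) ![r, t])
        (X.conn L.e (prodObj A.srt Γ) ![]) ≤ A.formula ψ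

/-- `A` is a model of the theory `T`. -/
def Models (A : Str Sg X) (T : Theory L Sg) : Prop := ∀ a ∈ T, A.Sat a

end Str

/-- `T ⊨ T'` in the prop-category `X`: every `T`-model in `X` is a `T'`-model. -/
def FA.Entails {L : FOLang.{l}} (X : FA.{l, u, v, w} L) {Sg : Signature.{s}}
    (T T' : Theory L Sg) : Prop :=
  ∀ A : Str Sg X, A.Models T → A.Models T'

/-- `X` is an object of `𝐅𝐀_Λ`: the logic `Λ` is sound in `X`. -/
def FA.IsModelOf {L : FOLang.{l}} (X : FA.{l, u, v, w} L) (Λ : Logic.{l, s} L) : Prop :=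
  ∀ (Sg : Signature.{s}) (T T' : Theory L Sg), Λ.Derives T T' → X.Entails T T'

/-! ### Morphisms -/

/-- Morphisms of `𝐅𝐀`: a functor preserving finite products (up to isomorphism) and a natural
transformation, compatible with connectives, quantifiers and equality. Here
`prodComparison o b c : o(b × c) ⟶ o(b) × o(c)` is the change-in-product isomorphism. -/
@[ext]
structure FA.Hom {L : FOLang.{l}} (X Y : FA.{l, u, v, w} L) where
  o : X.C ⥤ Y.C
  p : X.P ⟶ o.op ⋙ Y.P
  preserves : Limits.PreservesFiniteProducts o
  map_conn {n : ℕ} (k : L.conn n) (c : X.C) (r : Fin n → X.Fib c) :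
    (p.app (op c) (X.conn k c r) : Y.Fib (o.obj c)) =
      Y.conn k (o.obj c) (fun i => p.app (op c) (r i))
  map_quant (q : L.quant) (b c : X.C) (r : X.Fib (b ⊗ c)) :
    (p.app (op b) (X.quant q b c r) : Y.Fib (o.obj b)) =
      Y.quant q (o.obj b) (o.obj c)
        (Y.pull (inv (prodComparison o b c)) (p.app (op (b ⊗ c)) r))
  map_Eq (c : X.C) :
    (p.app (op (c ⊗ c)) (X.Eq c) : Y.Fib (o.obj (c ⊗ c))) =
      Y.pull (prodComparison o c c) (Y.Eq (o.obj c))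

namespace FA.Hom

variable {L : FOLang.{l}} {X Y Z : FA.{l, u, v, w} L}

/-- The map on fibres `F^p_c : P(c) → Q(F^o c)`. -/
def fib (F : FA.Hom X Y) (c : X.C) (r : X.Fib c) : Y.Fib (F.o.obj c) := F.p.app (op c) r

theorem pull_id {c : X.C} (r : X.Fib c) : X.pull (𝟙 c) r = r := by
  simp [PropCat.pull]

theorem pull_comp {b c d : X.C} (f : b ⟶ c) (g : c ⟶ d) (r : X.Fib d) :
    X.pull (f ≫ g) r = X.pull f (X.pull g r) := by
  simp [PropCat.pull]

theorem fib_pull (F : FA.Hom X Y) {c d : X.C} (f : c ⟶ d) (r : X.Fib d) :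
    F.fib c (X.pull f r) = Y.pull (F.o.map f) (F.fib d r) :=
  ConcreteCategory.congr_hom (F.p.naturality f.op) r

theorem fib_conn (F : FA.Hom X Y) {n : ℕ} (k : L.conn n) (c : X.C) (r : Fin n → X.Fib c) :
    F.fib c (X.conn k c r) = Y.conn k (F.o.obj c) (fun i => F.fib c (r i)) :=
  F.map_conn k c r

theorem fib_quant (F : FA.Hom X Y) [Limits.PreservesFiniteProducts F.o] (q : L.quant) (b c : X.C)
    (r : X.Fib (b ⊗ c)) :
    F.fib b (X.quant q b c r) = Y.quant q (F.o.obj b) (F.o.obj c)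
      (Y.pull (inv (prodComparison F.o b c)) (F.fib (b ⊗ c) r)) :=
  F.map_quant q b c r

theorem fib_Eq (F : FA.Hom X Y) (c : X.C) :
    F.fib (c ⊗ c) (X.Eq c) = Y.pull (prodComparison F.o c c) (Y.Eq (F.o.obj c)) :=
  F.map_Eq c

/-- The identity morphism. -/
def id (X : FA.{l, u, v, w} L) : FA.Hom X X where
  o := 𝟭 X.C
  p := 𝟙 X.P
  preserves := inferInstance
  map_conn _ _ _ := rfl
  map_quant q b c r := by
    have h : inv (prodComparison (𝟭 X.C) b c) = 𝟙 (b ⊗ c) := by simp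
    have h' : X.pull (inv (prodComparison (𝟭 X.C) b c)) r = r := by
      rw [h]
      exact pull_id r
    exact congrArg (X.quant q b c) h'.symm
  map_Eq c := by
    have h : prodComparison (𝟭 X.C) c c = 𝟙 (c ⊗ c) := prodComparison_id
    simp only [h]
    exact (pull_id (X.Eq c)).symm

/-- The composite `G ∘ F`. -/
def comp (F : FA.Hom X Y) (G : FA.Hom Y Z) : FA.Hom X Z where
  o := F.o ⋙ G.o
  p := F.p ≫ Functor.whiskerLeft F.o.op G.p
  preserves := by
    have := F.preserves
    have := G.preserves
    infer_instance
  map_conn k c r := by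
    change G.fib _ (F.fib c (X.conn k c r)) = _
    rw [fib_conn, fib_conn]
    rfl
  map_quant q b c r := by
    have := F.preserves
    have := G.preserves
    have h : inv (prodComparison (F.o ⋙ G.o) b c) =
        inv (prodComparison G.o (F.o.obj b) (F.o.obj c)) ≫
          G.o.map (inv (prodComparison F.o b c)) := by
      simp [prodComparison_comp]
    change G.fib _ (F.fib b (X.quant q b c r)) = _
    rw [fib_quant, fib_quant, fib_pull, h, pull_comp]
    rfl
  map_Eq c := by
    change G.fib _ (F.fib _ (X.Eq c)) = _
    rw [fib_Eq, fib_pull, fib_Eq, prodComparison_comp, pull_comp]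
    rfl

end FA.Hom

instance FA.category (L : FOLang.{l}) : Category (FA.{l, u, v, w} L) where
  Hom := FA.Hom
  id := FA.Hom.id
  comp := FA.Hom.comp

/-- Bijective on objects, full, and surjective on each fibre. -/
structure FA.Hom.IsQuotient {L : FOLang.{l}} {X Y : FA.{l, u, v, w} L} (F : FA.Hom X Y) :
    Prop where
  bijective : Function.Bijective F.o.obj
  full : F.o.Full
  surjective : ∀ c : X.C, Function.Surjective (F.fib c)

/-- Subprop-morphisms: faithful, and an order embedding on each fibre. -/
structure FA.Hom.IsSubprop {L : FOLang.{l}} {X Y : FA.{l, u, v, w} L} (F : FA.Hom X Y) :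
    Prop where
  faithful : F.o.Faithful
  embedding : ∀ (c : X.C) (r₁ r₂ : X.Fib c), F.fib c r₁ ≤ F.fib c r₂ ↔ r₁ ≤ r₂

/-! ### Kernels -/

/-- Triples of relations: on the objects, on the morphisms, and on the disjoint union of the
fibres. -/
@[ext]
structure Kernel {L : FOLang.{l}} (X : FA.{l, u, v, w} L) where
  obj : X.C → X.C → Prop
  mor : Arrow X.C → Arrow X.C → Prop
  fib : (Σ c : X.C, X.Fib c) → (Σ c : X.C, X.Fib c) → Prop

/-- Componentwise containment of relations. -/
instance {L : FOLang.{l}} (X : FA.{l, u, v, w} L) : LE (Kernel X) where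
  le k k' := k.obj ≤ k'.obj ∧ k.mor ≤ k'.mor ∧ k.fib ≤ k'.fib

/-- The kernel of a morphism. Two morphisms of the base are related if their images have the same
source and the same target and are equal. The order on the disjoint union of the fibres `Q(d)` is
the disjoint union of their orders: elements of different fibres are incomparable. -/
def FA.Hom.ker {L : FOLang.{l}} {X Y : FA.{l, u, v, w} L} (F : FA.Hom X Y) : Kernel X where
  obj c₁ c₂ := F.o.obj c₁ = F.o.obj c₂
  mor f₁ f₂ := F.o.mapArrow.obj f₁ = F.o.mapArrow.obj f₂
  fib r₁ r₂ := (⟨F.o.obj r₁.1, F.fib r₁.1 r₁.2⟩ : Σ d : Y.C, Y.Fib d) ≤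
    ⟨F.o.obj r₂.1, F.fib r₂.1 r₂.2⟩

end FibUA

/-! For the factorization, take the image of `F`. Its objects are those of the source, without
identification; its morphisms and predicates are the `F`-images of those of the source, with the
order induced from the target. Since `F` commutes up to the comparison isomorphisms with products,
connectives, quantifiers and equality, these operations restrict to images, and each axiom of the
image is the image of the same axiom of the source.

The image belongs to `𝐅𝐀_Λ` because subprop-morphisms reflect soundness. A structure `A` in the
image is carried to a structure in the target whose interpretations agree with those of `A` up to
the invertible comparison of contexts (`Str.map_term`, `Str.map_formula`). Faithfulness reflects
equations and the order embeddings reflect sequents, so `A` and its transport satisfy the same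
assertions (`Str.sat_map_iff`).

For the universal property, everything in the codomain of `K` comes from its source, up to a product
comparison. Hence `H` is forced on objects, morphisms and predicates (`FA.Hom.comp_left_cancel`),
and `ker K ≤ ker F` says exactly that the forced values are well defined and monotone. The remaining
conditions on `H` are checked on elements in the image of `K`, where they become the conditions on
`F` (`FA.Hom.exists_comp_eq`). -/

namespace FibUA

/-! ### Products over contexts and their comparison under a functor. -/

section Products

variable {C : Type u} [Category.{v} C] [CartesianMonoidalCategory C] {S : Type s}

theorem tuple_proj (I : S → C) {A : C} : {Γ : Ctx S} → {σ : S} →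
    (g : ∀ σ : S, Var Γ σ → (A ⟶ I σ)) → (x : Var Γ σ) → tuple I Γ g ≫ proj I x = g σ x
  | .snoc .nil _, _, _, .here => Category.comp_id _
  | .snoc (.snoc _ _) _, _, _, .here => lift_snd _ _
  | .snoc (.snoc _ _) _, _, g, .there x =>
      (lift_fst_assoc _ _ _).trans (tuple_proj I (fun ρ x => g ρ (.there x)) x)

theorem prodObj_hom_ext (I : S → C) {A : C} : {Γ : Ctx S} → {f g : A ⟶ prodObj I Γ} →
    (∀ (σ : S) (x : Var Γ σ), f ≫ proj I x = g ≫ proj I x) → f = g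
  | .nil, _, _, _ => toUnit_unique _ _
  | .snoc .nil σ, f, g, h =>
      ((Category.comp_id f).symm.trans (h σ .here)).trans (Category.comp_id g)
  | .snoc (.snoc _ _) σ, f, g, h =>
      CartesianMonoidalCategory.hom_ext f g
        (prodObj_hom_ext I fun ρ x =>
          ((Category.assoc _ _ _).trans (h ρ (.there x))).trans (Category.assoc _ _ _).symm)
        (h σ .here)

theorem comp_tuple (I : S → C) {A B : C} (h : A ⟶ B) (Γ : Ctx S)
    (g : ∀ σ : S, Var Γ σ → (B ⟶ I σ)) :
    h ≫ tuple I Γ g = tuple I Γ (fun σ x => h ≫ g σ x) :=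
  prodObj_hom_ext I fun σ x => by rw [Category.assoc, tuple_proj, tuple_proj]

theorem snocMap_proj_here (I : S → C) (Γ : Ctx S) (σ : S) :
    snocMap I Γ σ ≫ proj I Var.here = snd _ _ := tuple_proj _ _ _

theorem snocMap_proj_there (I : S → C) (Γ : Ctx S) (σ : S) {τ : S} (x : Var Γ τ) :
    snocMap I Γ σ ≫ proj I (Var.there x) = fst _ _ ≫ proj I x := tuple_proj _ _ _

variable {D : Type*} [Category* D] [CartesianMonoidalCategory D] (G : C ⥤ D)

/-- The comparison `G (⟦σ₁⟧ × ⋯ × ⟦σₙ⟧) ⟶ G ⟦σ₁⟧ × ⋯ × G ⟦σₙ⟧`. -/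
def ctxComparison (I : S → C) (Γ : Ctx S) :
    G.obj (prodObj I Γ) ⟶ prodObj (fun σ => G.obj (I σ)) Γ :=
  tuple (fun σ => G.obj (I σ)) Γ (fun _ x => G.map (proj I x))

theorem ctxComparison_proj (I : S → C) {Γ : Ctx S} {σ : S} (x : Var Γ σ) :
    ctxComparison G I Γ ≫ proj (fun σ => G.obj (I σ)) x = G.map (proj I x) :=
  tuple_proj _ _ _

theorem map_tuple_ctxComparison (I : S → C) {A : C} (Γ : Ctx S)
    (g : ∀ σ : S, Var Γ σ → (A ⟶ I σ)) :
    G.map (tuple I Γ g) ≫ ctxComparison G I Γ =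
      tuple (fun σ => G.obj (I σ)) Γ (fun σ x => G.map (g σ x)) :=
  prodObj_hom_ext _ fun σ x => by
    rw [Category.assoc, ctxComparison_proj, tuple_proj, ← G.map_comp, tuple_proj]

/-- Both sides have the same projections. This square carries the quantifier case of
`Str.map_formula`. -/
theorem map_snocMap_ctxComparison (I : S → C) (Γ : Ctx S) (σ : S) :
    G.map (snocMap I Γ σ) ≫ ctxComparison G I (Γ.snoc σ) =
      prodComparison G (prodObj I Γ) (I σ) ≫ (ctxComparison G I Γ ▷ G.obj (I σ)) ≫
        snocMap (fun σ => G.obj (I σ)) Γ σ :=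
  prodObj_hom_ext _ fun τ x => by
    rw [Category.assoc, ctxComparison_proj, ← G.map_comp]
    cases x with
    | here => simp [snocMap_proj_here]
    | there x =>
      simp [snocMap_proj_there, ctxComparison_proj]

/-- The comparison is built by iterating the binary one. The clauses follow `prodObj`, where a
one-variable context is the bare object, so the recursion has two base cases. -/
theorem isIso_ctxComparison [Limits.PreservesFiniteProducts G] (I : S → C) :
    (Γ : Ctx S) → IsIso (ctxComparison G I Γ)
  | .nil => by
      have h : ctxComparison G I .nil = terminalComparison G := toUnit_unique _ _
      have : IsIso (terminalComparison G) := inferInstance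
      exact h ▸ this
  | .snoc .nil σ => by
      have h : ctxComparison G I (.snoc .nil σ) = 𝟙 (G.obj (I σ)) := G.map_id _
      have : IsIso (𝟙 (G.obj (I σ))) := inferInstance
      exact h ▸ this
  | .snoc (.snoc Γ τ) σ => by
      have := isIso_ctxComparison I (.snoc Γ τ)
      have h : ctxComparison G I ((Γ.snoc τ).snoc σ) =
          prodComparison G (prodObj I (Γ.snoc τ)) (I σ) ≫
            (ctxComparison G I (Γ.snoc τ) ▷ G.obj (I σ)) :=
        prodObj_hom_ext (Γ := (Γ.snoc τ).snoc σ) _ fun ρ x =>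
          match ρ, x with
          | _, .here => (ctxComparison_proj G I _).trans
              (show G.map (snd _ _) = (prodComparison G (prodObj I (Γ.snoc τ)) (I σ) ≫
                (ctxComparison G I (Γ.snoc τ) ▷ G.obj (I σ))) ≫ snd _ _ by simp)
          | _, .there x => (ctxComparison_proj G I _).trans
              (show G.map (fst _ _ ≫ proj I x) = (prodComparison G (prodObj I (Γ.snoc τ)) (I σ) ≫
                (ctxComparison G I (Γ.snoc τ) ▷ G.obj (I σ))) ≫ fst _ _ ≫ proj _ x by
                simp [ctxComparison_proj])
      have : IsIso (prodComparison G (prodObj I (Γ.snoc τ)) (I σ) ≫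
            (ctxComparison G I (Γ.snoc τ) ▷ G.obj (I σ))) := inferInstance
      exact h ▸ this

end Products

/-! ### Transport of structures and reflection of soundness. -/

namespace Str

variable {L : FOLang.{l}} {Sg : Signature.{s}} {X Y : FA.{l, u, v, w} L}

open FA.Hom

/-- The image of a structure under a morphism. -/
noncomputable abbrev map (G : FA.Hom X Y) (A : Str Sg X) : Str Sg Y where
  srt σ := G.o.obj (A.srt σ)
  fn f :=
    have := G.preserves
    have := isIso_ctxComparison G.o A.srt
    inv (ctxComparison G.o A.srt (Sg.fnDom f)) ≫ G.o.map (A.fn f)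
  rel R :=
    have := G.preserves
    have := isIso_ctxComparison G.o A.srt
    Y.pull (inv (ctxComparison G.o A.srt (Sg.relDom R))) (G.fib _ (A.rel R))

variable (G : FA.Hom X Y) (A : Str Sg X)

theorem ctxComparison_fn (f : Sg.Fn) :
    ctxComparison G.o A.srt (Sg.fnDom f) ≫ (A.map G).fn f = G.o.map (A.fn f) := by
  have := G.preserves
  have := isIso_ctxComparison G.o A.srt
  exact IsIso.hom_inv_id_assoc _ _

theorem pull_ctxComparison_rel (R : Sg.Rel) :
    Y.pull (ctxComparison G.o A.srt (Sg.relDom R)) ((A.map G).rel R) = G.fib _ (A.rel R) := by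
  have := G.preserves
  have := isIso_ctxComparison G.o A.srt
  rw [← pull_comp, IsIso.hom_inv_id, pull_id]

theorem map_term {Γ : Ctx Sg.Srt} : {τ : Sg.Srt} → (M : Term Sg Γ τ) →
    G.o.map (A.term M) = ctxComparison G.o A.srt Γ ≫ (A.map G).term M
  | _, .var x => (ctxComparison_proj G.o A.srt x).symm
  | _, .app f args => by
      have ih := fun σ x => map_term (args σ x)
      have h : G.o.map (tuple A.srt (Sg.fnDom f) fun σ x => A.term (args σ x)) ≫
          ctxComparison G.o A.srt (Sg.fnDom f) = ctxComparison G.o A.srt Γ ≫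
            tuple (A.map G).srt (Sg.fnDom f) fun σ x => (A.map G).term (args σ x) := by
        rw [map_tuple_ctxComparison, comp_tuple]
        simp only [ih]
      rw [term, term, G.o.map_comp, ← Category.assoc (ctxComparison G.o A.srt Γ), ← h,
        Category.assoc, ctxComparison_fn]

theorem map_tuple_term {Γ Δ : Ctx Sg.Srt} (M : ∀ σ : Sg.Srt, Var Δ σ → Term Sg Γ σ) :
    G.o.map (tuple A.srt Δ fun σ x => A.term (M σ x)) ≫ ctxComparison G.o A.srt Δ =
      ctxComparison G.o A.srt Γ ≫ tuple (A.map G).srt Δ fun σ x => (A.map G).term (M σ x) := by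
  rw [map_tuple_ctxComparison, comp_tuple]
  simp only [map_term]

/-- Induction on formulas: each clause of the interpretation uses an operation that `G` preserves
and that is stable under reindexing along the comparison. Only equalities are used, so no
monotonicity of connectives or quantifiers is needed. -/
theorem map_formula : {Γ : Ctx Sg.Srt} → (φ : Formula L Sg Γ) →
    G.fib _ (A.formula φ) = Y.pull (ctxComparison G.o A.srt Γ) ((A.map G).formula φ)
  | Γ, .rel R args => by
      rw [formula, formula, fib_pull, ← pull_comp, ← map_tuple_term, pull_comp,
        pull_ctxComparison_rel]
  | Γ, .eq (σ := σ) M N => by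
      have e : G.o.map (lift (A.term M) (A.term N)) ≫ prodComparison G.o _ _ =
          ctxComparison G.o A.srt Γ ≫ lift ((A.map G).term M) ((A.map G).term N) := by
        rw [comp_lift, ← map_term, ← map_term]
        ext <;> simp [← G.o.map_comp]
      rw [formula, formula, fib_pull, fib_Eq, ← pull_comp, e, pull_comp]
  | Γ, .conn k φ => by
      have ih := fun i => map_formula (φ i)
      rw [formula, formula, fib_conn, Y.pull_conn]
      simp only [ih]
  | Γ, .quant q σ φ => by
      have := G.preserves
      have e : inv (prodComparison G.o (prodObj A.srt Γ) (A.srt σ)) ≫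
          G.o.map (snocMap A.srt Γ σ) ≫ ctxComparison G.o A.srt (Γ.snoc σ) =
          (ctxComparison G.o A.srt Γ ▷ G.o.obj (A.srt σ)) ≫ snocMap (A.map G).srt Γ σ := by
        rw [map_snocMap_ctxComparison, IsIso.inv_hom_id_assoc]
      rw [formula, formula, fib_quant, fib_pull, map_formula φ, Y.pull_quant]
      simp only [← pull_comp, e]

theorem map_foldr_tensor {Γ : Ctx Sg.Srt} (Φ : List (Formula L Sg Γ)) :
    G.fib _ ((Φ.map A.formula).foldr (fun r t => X.conn L.tensor (prodObj A.srt Γ) ![r, t])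
        (X.conn L.e (prodObj A.srt Γ) ![])) =
      Y.pull (ctxComparison G.o A.srt Γ) ((Φ.map (A.map G).formula).foldr
        (fun r t => Y.conn L.tensor (prodObj (A.map G).srt Γ) ![r, t])
        (Y.conn L.e (prodObj (A.map G).srt Γ) ![])) := by
  induction Φ with
  | nil =>
    simp only [List.map_nil, List.foldr_nil]
    rw [fib_conn, Y.pull_conn]
    congr 1
    exact Subsingleton.elim _ _
  | cons φ Φ ih =>
    simp only [List.map_cons, List.foldr_cons]
    rw [fib_conn, Y.pull_conn]
    congr 1
    funext i
    match i with
    | 0 => exact map_formula G A φ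
    | 1 => exact ih

theorem pull_le_pull_iff {c d : Y.C} (f : c ⟶ d) [IsIso f] (r₁ r₂ : Y.Fib d) :
    Y.pull f r₁ ≤ Y.pull f r₂ ↔ r₁ ≤ r₂ := by
  refine ⟨fun h => ?_, fun h => (Y.P.map f.op).hom.monotone h⟩
  have : Y.pull (inv f) (Y.pull f r₁) ≤ Y.pull (inv f) (Y.pull f r₂) :=
    (Y.P.map (inv f).op).hom.monotone h
  rwa [← pull_comp, ← pull_comp, IsIso.inv_hom_id, pull_id, pull_id] at this

variable {G}

/-- Equations are reflected by faithfulness and sequents by the order embeddings, once the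
invertible context comparison is cancelled. -/
theorem sat_map_iff (hG : G.IsSubprop) (a : Assertion L Sg) : (A.map G).Sat a ↔ A.Sat a := by
  have := G.preserves
  have := hG.faithful
  cases a with
  | eqn Γ σ M N =>
    have := isIso_ctxComparison G.o A.srt Γ
    change (A.map G).term M = (A.map G).term N ↔ A.term M = A.term N
    rw [← G.o.map_injective.eq_iff, map_term, map_term, cancel_epi]
  | seq Γ Φ ψ =>
    have := isIso_ctxComparison G.o A.srt Γ
    change _ ≤ _ ↔ _ ≤ _
    rw [← hG.embedding, map_foldr_tensor, map_formula, pull_le_pull_iff]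

end Str

theorem FA.Hom.IsSubprop.isModelOf {L : FOLang.{l}} {X Y : FA.{l, u, v, w} L} {G : FA.Hom X Y}
    (hG : G.IsSubprop) {Λ : Logic.{l, s} L} (hY : Y.IsModelOf Λ) : X.IsModelOf Λ :=
  fun Sg T T' hT A hA a ha => (A.sat_map_iff hG a).1
    (hY Sg T T' hT (A.map G) (fun b hb => (A.sat_map_iff hG b).2 (hA b hb)) a ha)

/-! ### The image of a functor preserving finite products. -/

theorem preservesFiniteProducts_of_isIso_prodComparison {C : Type*} [Category* C]
    [CartesianMonoidalCategory C] {D : Type*} [Category* D] [CartesianMonoidalCategory D] (G : C ⥤ D)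
    [IsIso (terminalComparison G)] [∀ b c, IsIso (prodComparison G b c)] :
    Limits.PreservesFiniteProducts G := by
  have := preservesLimitsOfShape_discrete_walkingPair_of_isIso_prodComparison G
  have := preservesLimit_empty_of_isIso_terminalComparison G
  have := Limits.preservesLimitsOfShape_pempty_of_preservesTerminal G
  exact .of_preserves_binary_and_terminal G

theorem associator_inv_eq_lift {C : Type*} [Category* C] [CartesianMonoidalCategory C] (a b c : C) :
    (α_ a b c).inv =
      lift (lift (fst a (b ⊗ c)) (snd a (b ⊗ c) ≫ fst b c)) (snd a (b ⊗ c) ≫ snd b c) := by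
  ext <;> simp

section ImageCategory

variable {C : Type*} [Category* C] {D : Type*} [Category* D]

/-- The image of a functor: its objects are those of the source, its morphisms are the images of
the morphisms of the source. -/
@[ext]
structure FunctorImage (F : C ⥤ D) where
  obj : C

namespace FunctorImage

/-- Morphisms of the target that are images of morphisms of the source. -/
@[ext]
structure Hom {F : C ⥤ D} (a b : FunctorImage F) where
  hom : F.obj a.obj ⟶ F.obj b.obj
  exists_map_eq : ∃ f : a.obj ⟶ b.obj, F.map f = hom

variable (F : C ⥤ D)

instance : Category (FunctorImage F) where
  Hom := Hom
  id a := ⟨𝟙 _, 𝟙 _, F.map_id _⟩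
  comp f g := ⟨f.hom ≫ g.hom, by
    obtain ⟨f, hf⟩ := f.exists_map_eq
    obtain ⟨g, hg⟩ := g.exists_map_eq
    exact ⟨f ≫ g, by rw [F.map_comp, hf, hg]⟩⟩
  id_comp f := Hom.ext (Category.id_comp f.hom)
  comp_id f := Hom.ext (Category.comp_id f.hom)
  assoc f g h := Hom.ext (Category.assoc f.hom g.hom h.hom)

/-- The corestriction of a functor to its image. -/
def toImage : C ⥤ FunctorImage F where
  obj c := ⟨c⟩
  map f := ⟨F.map f, f, rfl⟩
  map_id _ := Hom.ext (F.map_id _)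
  map_comp _ _ := Hom.ext (F.map_comp _ _)

/-- The inclusion of the image of a functor into its target. -/
def inclusion : FunctorImage F ⥤ D where
  obj a := F.obj a.obj
  map f := f.hom

instance : (inclusion F).Faithful where
  map_injective h := Hom.ext h

instance : (toImage F).Full where
  map_surjective f := ⟨f.exists_map_eq.choose, Hom.ext f.exists_map_eq.choose_spec⟩

theorem toImage_obj_bijective : Function.Bijective (toImage F).obj :=
  ⟨fun _ _ h => congrArg FunctorImage.obj h, fun a => ⟨a.obj, rfl⟩⟩

variable {F} in
theorem toImage_map_eq_iff {c d : C} {f g : c ⟶ d} :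
    (toImage F).map f = (toImage F).map g ↔ F.map f = F.map g :=
  ⟨fun h => congrArg Hom.hom h, fun h => Hom.ext h⟩

variable [CartesianMonoidalCategory C] [CartesianMonoidalCategory D]
  [Limits.PreservesFiniteProducts F]

/-- The comparison is monic, so `F` carries the projections to a jointly monic pair. This gives
uniqueness of pairings in the image, independently of the chosen preimages. -/
theorem map_hom_ext {a b c : C} {f g : a ⟶ b ⊗ c} (h₁ : F.map (f ≫ fst b c) = F.map (g ≫ fst b c))
    (h₂ : F.map (f ≫ snd b c) = F.map (g ≫ snd b c)) : F.map f = F.map g := by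
  rw [← cancel_mono (prodComparison F b c)]
  ext
  · simpa only [Category.assoc, prodComparison_fst, ← F.map_comp] using h₁
  · simpa only [Category.assoc, prodComparison_snd, ← F.map_comp] using h₂

/-- The terminal object of the image. -/
def terminalCone : Limits.LimitCone (Functor.empty.{0} (FunctorImage F)) where
  cone := Limits.asEmptyCone ((toImage F).obj (𝟙_ C))
  isLimit := Limits.IsTerminal.ofUniqueHom (fun a => (toImage F).map (toUnit a.obj)) (by
    intro a f
    obtain ⟨f, rfl⟩ := (toImage F).map_surjective (X := a.obj) f
    rw [toUnit_unique f (toUnit _)])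

/-- The binary products of the image. -/
noncomputable def productCone (a b : FunctorImage F) : Limits.LimitCone (Limits.pair a b) where
  cone := Limits.BinaryFan.mk (P := (toImage F).obj (a.obj ⊗ b.obj))
    ((toImage F).map (fst a.obj b.obj)) ((toImage F).map (snd a.obj b.obj))
  isLimit := Limits.BinaryFan.IsLimit.mk _
    (fun {T} f g => (toImage F).map (X := T.obj) (Y := a.obj ⊗ b.obj)
      (lift ((toImage F).preimage (X := T.obj) f) ((toImage F).preimage (X := T.obj) g)))
    (fun {T} f g => by
      refine ((toImage F).map_comp _ _).symm.trans ?_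
      rw [lift_fst]
      exact (toImage F).map_preimage (X := T.obj) (Y := a.obj) f)
    (fun {T} f g => by
      refine ((toImage F).map_comp _ _).symm.trans ?_
      rw [lift_snd]
      exact (toImage F).map_preimage (X := T.obj) (Y := b.obj) g)
    (fun {T} f g m hf hg => by
      obtain ⟨m, rfl⟩ := (toImage F).map_surjective (X := T.obj) (Y := a.obj ⊗ b.obj) m
      refine toImage_map_eq_iff.2 (map_hom_ext F ?_ ?_)
      · rw [lift_fst]
        exact toImage_map_eq_iff.1 (((toImage F).map_comp _ _).trans
          (hf.trans ((toImage F).map_preimage (X := T.obj) (Y := a.obj) f).symm))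
      · rw [lift_snd]
        exact toImage_map_eq_iff.1 (((toImage F).map_comp _ _).trans
          (hg.trans ((toImage F).map_preimage (X := T.obj) (Y := b.obj) g).symm)))

/-- With products chosen as images of those of `C`, the corestriction preserves them strictly and
its comparison maps are identities. -/
noncomputable instance : CartesianMonoidalCategory (FunctorImage F) :=
  .ofChosenFiniteProducts (terminalCone F) (productCone F)

variable {F}

theorem toImage_map_fst (b c : C) :
    (toImage F).map (fst b c) = fst ((toImage F).obj b) ((toImage F).obj c) := rfl

theorem toImage_map_snd (b c : C) :
    (toImage F).map (snd b c) = snd ((toImage F).obj b) ((toImage F).obj c) := rfl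

theorem toImage_map_lift {a b c : C} (f : a ⟶ b) (g : a ⟶ c) :
    (toImage F).map (lift f g) = lift ((toImage F).map f) ((toImage F).map g) :=
  CartesianMonoidalCategory.hom_ext _ _
    ((((toImage F).map_comp _ _).symm.trans (by rw [lift_fst])).trans (lift_fst _ _).symm)
    ((((toImage F).map_comp _ _).symm.trans (by rw [lift_snd])).trans (lift_snd _ _).symm)

theorem toImage_map_whiskerRight {a b : C} (f : a ⟶ b) (c : C) :
    (toImage F).map (f ▷ c) = (toImage F).map f ▷ (toImage F).obj c := by
  have e₁ : f ▷ c = lift (fst a c ≫ f) (snd a c) := by ext <;> simp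
  have e₂ : (toImage F).map f ▷ (toImage F).obj c =
    lift (fst _ _ ≫ (toImage F).map f) (snd _ _) := by ext <;> simp
  rw [e₁, e₂, ← toImage_map_fst, ← toImage_map_snd]
  exact (toImage_map_lift _ _).trans (by rw [(toImage F).map_comp]; rfl)

theorem toImage_map_associator_inv (a b c : C) :
    (toImage F).map (α_ a b c).inv =
      (α_ ((toImage F).obj a) ((toImage F).obj b) ((toImage F).obj c)).inv := by
  rw [associator_inv_eq_lift]
  refine .trans ?_ (associator_inv_eq_lift _ _ _).symm
  refine (toImage_map_lift _ _).trans ?_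
  rw [toImage_map_lift, (toImage F).map_comp, (toImage F).map_comp]
  rfl

theorem prodComparison_toImage (b c : C) :
    prodComparison (toImage F) b c = 𝟙 ((toImage F).obj b ⊗ (toImage F).obj c) :=
  CartesianMonoidalCategory.hom_ext _ _
    ((prodComparison_fst _ _ _).trans (Category.id_comp _).symm)
    ((prodComparison_snd _ _ _).trans (Category.id_comp _).symm)

theorem preservesFiniteProducts_toImage : Limits.PreservesFiniteProducts (toImage F) := by
  have : IsIso (terminalComparison (toImage F)) := by
    have h : terminalComparison (toImage F) = 𝟙 ((toImage F).obj (𝟙_ C)) := toUnit_unique _ _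
    have : IsIso (𝟙 ((toImage F).obj (𝟙_ C))) := inferInstance
    exact h ▸ this
  have (b c : C) : IsIso (prodComparison (toImage F) b c) := by
    have : IsIso (𝟙 ((toImage F).obj b ⊗ (toImage F).obj c)) := inferInstance
    exact prodComparison_toImage (F := F) b c ▸ this
  exact preservesFiniteProducts_of_isIso_prodComparison _

theorem preservesFiniteProducts_inclusion : Limits.PreservesFiniteProducts (inclusion F) := by
  have : IsIso (terminalComparison (inclusion F)) :=
    inferInstanceAs (IsIso (terminalComparison F))
  have (b c : FunctorImage F) : IsIso (prodComparison (inclusion F) b c) :=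
    inferInstanceAs (IsIso (prodComparison F b.obj c.obj))
  exact preservesFiniteProducts_of_isIso_prodComparison _

end FunctorImage
end ImageCategory
-- The image of a morphism and the resulting factorization.
namespace FA.Hom

variable {L : FOLang.{l}} {X Y : FA.{l, u, v, w} L} (F : FA.Hom X Y)

instance : Limits.PreservesFiniteProducts F.o := F.preserves

/-- The image prop-category: its fibres are the images of the fibres of the source. -/
noncomputable def imagePropCat : PropCat.{u, v, w} where
  C := FunctorImage F.o
  P :=
    { obj := fun a => PartOrd.of {r : Y.Fib (F.o.obj a.unop.obj) // ∃ r', F.fib a.unop.obj r' = r}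
      map := fun f => PartOrd.ofHom
        ⟨fun r => ⟨Y.pull f.unop.hom r.1, by
          obtain ⟨g, hg⟩ := f.unop.exists_map_eq
          obtain ⟨r, r', rfl⟩ := r
          exact ⟨X.pull g r', by rw [fib_pull, hg]⟩⟩,
        fun _ _ h => (Y.P.map f.unop.hom.op).hom.monotone h⟩
      map_id := fun a => PartOrd.ext fun r => Subtype.ext (pull_id (X := Y) r.1)
      map_comp := fun f g => PartOrd.ext fun r => Subtype.ext
        (pull_comp (X := Y) g.unop.hom f.unop.hom r.1) }

/-- The objects of the source, as objects of the image. -/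
def imageObj (c : X.C) : F.imagePropCat.C := (FunctorImage.toImage F.o).obj c

/-- The morphisms of the source, as morphisms of the image. -/
def imageMap {c d : X.C} (f : c ⟶ d) : F.imageObj c ⟶ F.imageObj d :=
  (FunctorImage.toImage F.o).map f

/-- The elements of the fibres of the source, as elements of the fibres of the image. -/
def imageFib (c : X.C) (r : X.Fib c) : F.imagePropCat.Fib (F.imageObj c) :=
  (⟨F.fib c r, r, rfl⟩ : {r : Y.Fib (F.o.obj c) // ∃ r', F.fib c r' = r})

theorem exists_imageMap_eq {c d : X.C} (f : F.imageObj c ⟶ F.imageObj d) :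
    ∃ g, F.imageMap g = f :=
  (FunctorImage.toImage F.o).map_surjective (X := c) (Y := d) f

theorem exists_imageFib_eq (c : X.C) (r : F.imagePropCat.Fib (F.imageObj c)) :
    ∃ r', F.imageFib c r' = r :=
  let ⟨r', h⟩ := r.2
  ⟨r', Subtype.ext h⟩

theorem pull_imageMap {c d : X.C} (f : c ⟶ d) (r : X.Fib d) :
    F.imagePropCat.pull (F.imageMap f) (F.imageFib d r) = F.imageFib c (X.pull f r) :=
  Subtype.ext (F.fib_pull f r).symm

/-- The connectives of the image. -/
def imageConn {n : ℕ} (k : L.conn n) (c : F.imagePropCat.C) (r : Fin n → F.imagePropCat.Fib c) :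
    F.imagePropCat.Fib c :=
  (⟨Y.conn k (F.o.obj c.obj) fun i => (r i).1, by
    choose r' h using fun i => (r i).2
    exact ⟨X.conn k c.obj r', by simp only [fib_conn, h]⟩⟩ :
      {r : Y.Fib (F.o.obj c.obj) // ∃ r', F.fib c.obj r' = r})

theorem imageConn_imageFib {n : ℕ} (k : L.conn n) (c : X.C) (r : Fin n → X.Fib c) :
    F.imageConn k (F.imageObj c) (fun i => F.imageFib c (r i)) = F.imageFib c (X.conn k c r) :=
  Subtype.ext (F.fib_conn k c r).symm

theorem imageConn_nil (k : L.conn 0) (c : X.C) :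
    F.imageConn k (F.imageObj c) ![] = F.imageFib c (X.conn k c ![]) := by
  rw [← imageConn_imageFib]
  congr 1
  exact Subsingleton.elim _ _

theorem imageConn_pair (k : L.conn 2) (c : X.C) (r₁ r₂ : X.Fib c) :
    F.imageConn k (F.imageObj c) ![F.imageFib c r₁, F.imageFib c r₂] =
      F.imageFib c (X.conn k c ![r₁, r₂]) := by
  rw [← imageConn_imageFib]
  congr 1
  funext i
  match i with
  | 0 => rfl
  | 1 => rfl

/-- The quantifiers of the image. -/
noncomputable def imageQuant (q : L.quant) (b c : F.imagePropCat.C)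
    (r : F.imagePropCat.Fib (b ⊗ c)) : F.imagePropCat.Fib b :=
  (⟨Y.quant q (F.o.obj b.obj) (F.o.obj c.obj)
      (Y.pull (inv (prodComparison F.o b.obj c.obj)) r.1), by
    obtain ⟨r', h⟩ := r.2
    exact ⟨X.quant q b.obj c.obj r', (F.fib_quant q _ _ r').trans (by rw [← h]; rfl)⟩⟩ :
      {r : Y.Fib (F.o.obj b.obj) // ∃ r', F.fib b.obj r' = r})

theorem imageQuant_imageFib (q : L.quant) (b c : X.C) (r : X.Fib (b ⊗ c)) :
    F.imageQuant q (F.imageObj b) (F.imageObj c) (F.imageFib (b ⊗ c) r) =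
      F.imageFib b (X.quant q b c r) :=
  Subtype.ext (F.fib_quant q b c r).symm

/-- The image of a morphism. -/
noncomputable def image : FA.{l, u, v, w} L where
  toPropCat := F.imagePropCat
  conn := F.imageConn
  pull_conn {_} k {c d} f r := by
    -- Here and in the axioms below, all data are replaced by images of data of `X`, which reduces
    -- the axiom to the one in `X`.
    obtain ⟨c, rfl⟩ : ∃ c', F.imageObj c' = c := ⟨c.obj, rfl⟩
    obtain ⟨d, rfl⟩ : ∃ d', F.imageObj d' = d := ⟨d.obj, rfl⟩
    obtain ⟨f, rfl⟩ := F.exists_imageMap_eq f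
    choose r' h using fun i => F.exists_imageFib_eq d (r i)
    obtain rfl := funext h
    simp only [imageConn_imageFib, pull_imageMap, X.pull_conn]
  -- By `fib_Eq` this is also the equality of `Y` reindexed along the comparison, as the inclusion
  -- requires.
  Eq c := F.imageFib (c.obj ⊗ c.obj) (X.Eq c.obj)
  quant := F.imageQuant
  pull_quant q {b b'} c f r := by
    obtain ⟨b, rfl⟩ : ∃ c', F.imageObj c' = b := ⟨b.obj, rfl⟩
    obtain ⟨b', rfl⟩ : ∃ d', F.imageObj d' = b' := ⟨b'.obj, rfl⟩
    obtain ⟨c, rfl⟩ : ∃ c', F.imageObj c' = c := ⟨c.obj, rfl⟩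
    obtain ⟨f, rfl⟩ := F.exists_imageMap_eq f
    obtain ⟨r, rfl⟩ := F.exists_imageFib_eq (b' ⊗ c) r
    have e : F.imagePropCat.pull (F.imageMap f ▷ F.imageObj c) (F.imageFib (b' ⊗ c) r) =
        F.imageFib (b ⊗ c) (X.pull (f ▷ c) r) :=
      (congrArg (fun g => F.imagePropCat.pull g (F.imageFib (b' ⊗ c) r))
        (FunctorImage.toImage_map_whiskerRight f c).symm).trans (F.pull_imageMap _ _)
    rw [e]
    refine (congrArg _ (F.imageQuant_imageFib q b' c r)).trans ?_
    rw [pull_imageMap, X.pull_quant]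
    exact (F.imageQuant_imageFib q b c _).symm
  tensor_assoc c r₁ r₂ r₃ := by
    obtain ⟨c, rfl⟩ : ∃ c', F.imageObj c' = c := ⟨c.obj, rfl⟩
    obtain ⟨r₁, rfl⟩ := F.exists_imageFib_eq c r₁
    obtain ⟨r₂, rfl⟩ := F.exists_imageFib_eq c r₂
    obtain ⟨r₃, rfl⟩ := F.exists_imageFib_eq c r₃
    simp only [imageConn_pair, X.tensor_assoc]
  e_tensor c r := by
    obtain ⟨c, rfl⟩ : ∃ c', F.imageObj c' = c := ⟨c.obj, rfl⟩
    obtain ⟨r, rfl⟩ := F.exists_imageFib_eq c r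
    simp only [imageConn_nil, imageConn_pair, X.e_tensor]
  tensor_e c r := by
    obtain ⟨c, rfl⟩ : ∃ c', F.imageObj c' = c := ⟨c.obj, rfl⟩
    obtain ⟨r, rfl⟩ := F.exists_imageFib_eq c r
    simp only [imageConn_nil, imageConn_pair, X.tensor_e]
  quant_unit q b r := by
    obtain ⟨b, rfl⟩ : ∃ c', F.imageObj c' = b := ⟨b.obj, rfl⟩
    obtain ⟨r, rfl⟩ := F.exists_imageFib_eq b r
    refine (congrArg (F.imageQuant q _ _) (F.pull_imageMap (fst b (𝟙_ X.C)) r)).trans ?_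
    refine (F.imageQuant_imageFib q b (𝟙_ X.C) _).trans ?_
    rw [X.quant_unit]
  quant_prod q b c d r := by
    obtain ⟨b, rfl⟩ : ∃ c', F.imageObj c' = b := ⟨b.obj, rfl⟩
    obtain ⟨c, rfl⟩ : ∃ c', F.imageObj c' = c := ⟨c.obj, rfl⟩
    obtain ⟨d, rfl⟩ : ∃ c', F.imageObj c' = d := ⟨d.obj, rfl⟩
    obtain ⟨r, rfl⟩ := F.exists_imageFib_eq ((b ⊗ c) ⊗ d) r
    have e : F.imagePropCat.pull (α_ (F.imageObj b) (F.imageObj c) (F.imageObj d)).inv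
        (F.imageFib ((b ⊗ c) ⊗ d) r) = F.imageFib (b ⊗ (c ⊗ d)) (X.pull (α_ b c d).inv r) :=
      (congrArg (fun g => F.imagePropCat.pull g (F.imageFib ((b ⊗ c) ⊗ d) r))
        (FunctorImage.toImage_map_associator_inv b c d).symm).trans (F.pull_imageMap _ _)
    rw [e]
    refine (F.imageQuant_imageFib q b (c ⊗ d) _).trans ?_
    rw [X.quant_prod, ← imageQuant_imageFib]
    exact congrArg (F.imageQuant q _ _) (F.imageQuant_imageFib q (b ⊗ c) d r).symm
  Eq_unit := (congrArg _ X.Eq_unit).trans (F.imageConn_nil L.e (𝟙_ X.C ⊗ 𝟙_ X.C)).symm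
  Eq_prod c₁ c₂ := by
    obtain ⟨c₁, rfl⟩ : ∃ c', F.imageObj c' = c₁ := ⟨c₁.obj, rfl⟩
    obtain ⟨c₂, rfl⟩ : ∃ c', F.imageObj c' = c₂ := ⟨c₂.obj, rfl⟩
    refine (congrArg (F.imageFib _) (X.Eq_prod c₁ c₂)).trans ?_
    refine (F.imageConn_pair _ _ _ _).symm.trans ?_
    rw [← pull_imageMap, ← pull_imageMap]
    have e₁ := FunctorImage.toImage_map_lift (F := F.o)
      (fst (c₁ ⊗ c₂) (c₁ ⊗ c₂) ≫ fst c₁ c₂) (snd (c₁ ⊗ c₂) (c₁ ⊗ c₂) ≫ fst c₁ c₂)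
    have e₂ := FunctorImage.toImage_map_lift (F := F.o)
      (fst (c₁ ⊗ c₂) (c₁ ⊗ c₂) ≫ snd c₁ c₂) (snd (c₁ ⊗ c₂) (c₁ ⊗ c₂) ≫ snd c₁ c₂)
    rw [Functor.map_comp, Functor.map_comp] at e₁ e₂
    exact congrArg₂ (fun f g => F.imageConn L.tensor _ ![F.imagePropCat.pull f
      (F.imageFib _ (X.Eq c₁)), F.imagePropCat.pull g (F.imageFib _ (X.Eq c₂))]) e₁ e₂

/-- The corestriction of a morphism to its image. -/
noncomputable def toImage : FA.Hom X F.image where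
  o := FunctorImage.toImage F.o
  p :=
    { app := fun c => PartOrd.ofHom ⟨F.imageFib c.unop, fun _ _ h => (F.p.app c).hom.monotone h⟩
      naturality := fun _ _ f => PartOrd.ext fun r => (F.pull_imageMap f.unop r).symm }
  preserves := FunctorImage.preservesFiniteProducts_toImage
  map_conn k c r := (F.imageConn_imageFib k c r).symm
  map_quant q b c r := by
    have : Limits.PreservesFiniteProducts (FunctorImage.toImage F.o) :=
      FunctorImage.preservesFiniteProducts_toImage
    have h : inv (prodComparison (FunctorImage.toImage F.o) b c) = 𝟙 _ :=
      IsIso.inv_eq_of_hom_inv_id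
        ((Category.comp_id _).trans (FunctorImage.prodComparison_toImage b c))
    have h' := (congrArg (fun g => F.image.pull g (F.imageFib (b ⊗ c) r)) h).trans
      (pull_id (X := F.image) _)
    exact (F.imageQuant_imageFib q b c r).symm.trans (congrArg (F.imageQuant q _ _) h').symm
  map_Eq c :=
    ((congrArg (fun g => F.image.pull g (F.imageFib (c ⊗ c) (X.Eq c)))
      (FunctorImage.prodComparison_toImage c c)).trans (pull_id (X := F.image) _)).symm

/-- The inclusion of the image of a morphism into its target. -/
noncomputable def imageInclusion : FA.Hom F.image Y where
  o := FunctorImage.inclusion F.o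
  p :=
    { app := fun _ => PartOrd.ofHom ⟨fun r => r.1, fun _ _ h => h⟩
      naturality := fun _ _ _ => rfl }
  preserves := FunctorImage.preservesFiniteProducts_inclusion
  map_conn _ _ _ := rfl
  map_quant _ _ _ _ := rfl
  map_Eq c := F.fib_Eq c.obj

theorem toImage_comp_imageInclusion : F.toImage.comp F.imageInclusion = F := rfl

theorem isQuotient_toImage : F.toImage.IsQuotient where
  bijective := FunctorImage.toImage_obj_bijective F.o
  full := inferInstanceAs (FunctorImage.toImage F.o).Full
  surjective := F.exists_imageFib_eq

theorem isSubprop_imageInclusion : F.imageInclusion.IsSubprop where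
  faithful := inferInstanceAs (FunctorImage.inclusion F.o).Faithful
  embedding _ _ _ := Iff.rfl

end FA.Hom
-- Factoring functors through a full functor surjective on objects.
theorem exists_functor_comp_eq {C D E : Type*} [Category* C] [Category* D] [Category* E]
    (K : C ⥤ E) (F : C ⥤ D) [K.Full] (hK : Function.Surjective K.obj)
    (hobj : ∀ c₁ c₂, K.obj c₁ = K.obj c₂ → F.obj c₁ = F.obj c₂)
    (hmap : ∀ f₁ f₂, K.mapArrow.obj f₁ = K.mapArrow.obj f₂ →
      F.mapArrow.obj f₁ = F.mapArrow.obj f₂) :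
    ∃ H : E ⥤ D, K ⋙ H = F := by
  have h₁ (e : E) : ∃ d, ∀ c, K.obj c = e → F.obj c = d := by
    obtain ⟨c, rfl⟩ := hK e
    exact ⟨F.obj c, fun c' h => hobj _ _ h⟩
  choose o ho using h₁
  -- Unpacking `F` lets its object map be replaced by the factored one, so that its morphisms
  -- acquire the required endpoints without transports.
  obtain ⟨Fo, Fm, Fid, Fcomp⟩ := F
  obtain rfl : Fo = fun c => o (K.obj c) := funext fun c => ho _ c rfl
  -- Since `K` may identify objects, two lifts of `g` can have different endpoints; they are
  -- therefore compared as arrows.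
  have h₂ (e₁ e₂ : E) (g : e₁ ⟶ e₂) : ∃ m : o e₁ ⟶ o e₂, ∀ (c₁ c₂ : C) (f : c₁ ⟶ c₂),
      Arrow.mk (K.map f) = Arrow.mk g → Arrow.mk (Fm f) = Arrow.mk m := by
    obtain ⟨c₁, rfl⟩ := hK e₁
    obtain ⟨c₂, rfl⟩ := hK e₂
    obtain ⟨f, rfl⟩ := K.map_surjective g
    exact ⟨Fm f, fun c₁' c₂' f' h => hmap (Arrow.mk f') (Arrow.mk f) h⟩
  choose m hm using h₂
  have hm' {c₁ c₂ : C} (f : c₁ ⟶ c₂) : m _ _ (K.map f) = Fm f :=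
    ((Arrow.mk_inj _ _).1 (hm _ _ _ _ _ f rfl)).symm
  refine ⟨{ obj := o, map := m _ _, map_id := ?_, map_comp := ?_ }, ?_⟩
  · intro e
    obtain ⟨c, rfl⟩ := hK e
    rw [← K.map_id, hm']
    exact Fid c
  · intro e₁ e₂ e₃ g₁ g₂
    obtain ⟨c₁, rfl⟩ := hK e₁
    obtain ⟨c₂, rfl⟩ := hK e₂
    obtain ⟨c₃, rfl⟩ := hK e₃
    obtain ⟨f₁, rfl⟩ := K.map_surjective g₁
    obtain ⟨f₂, rfl⟩ := K.map_surjective g₂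
    rw [← K.map_comp, hm', hm', hm']
    exact Fcomp f₁ f₂
  · refine CategoryTheory.Functor.ext (fun _ => rfl) fun c₁ c₂ f => ?_
    simp [hm']

theorem functor_eq_of_comp_eq {C D E : Type*} [Category* C] [Category* D] [Category* E]
    {K : C ⥤ E} [K.Full] (hK : Function.Surjective K.obj) {H₁ H₂ : E ⥤ D}
    (h : K ⋙ H₁ = K ⋙ H₂) : H₁ = H₂ := by
  refine Functor.hext (fun e => ?_) fun e₁ e₂ g => ?_
  · obtain ⟨c, rfl⟩ := hK e
    exact Functor.congr_obj h c
  · obtain ⟨c₁, rfl⟩ := hK e₁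
    obtain ⟨c₂, rfl⟩ := hK e₂
    obtain ⟨f, rfl⟩ := K.map_surjective g
    exact Functor.hcongr_hom h f

/-! ### Kernels and factorization of morphisms of prop-categories. -/

namespace FA.Hom

variable {L : FOLang.{l}} {X Y Z : FA.{l, u, v, w} L} {K : FA.Hom X Z}

theorem ker_le_ker_comp (K : FA.Hom X Z) (H : FA.Hom Z Y) : K.ker ≤ (K.comp H).ker := by
  refine ⟨fun _ _ h => congrArg H.o.obj h, fun _ _ h => congrArg H.o.mapArrow.obj h, ?_⟩
  rintro ⟨c₁, r₁⟩ ⟨c₂, r₂⟩ h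
  change (⟨_, K.fib c₁ r₁⟩ : Σ d : Z.C, Z.Fib d) ≤ ⟨_, K.fib c₂ r₂⟩ at h
  change (⟨_, H.fib _ (K.fib c₁ r₁)⟩ : Σ d : Y.C, Y.Fib d) ≤ ⟨_, H.fib _ (K.fib c₂ r₂)⟩
  -- The base objects must become variables before case analysis on the order of the disjoint union
  -- can identify them.
  generalize K.fib c₁ r₁ = r₁ at *
  generalize K.fib c₂ r₂ = r₂ at *
  generalize K.o.obj c₁ = c₁ at *
  generalize K.o.obj c₂ = c₂ at *
  cases h with
  | fiber _ _ _ h => exact .fiber _ _ _ ((H.p.app (op c₁)).hom.monotone h)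

theorem comp_left_cancel (hfull : K.o.Full) (hobj : Function.Surjective K.o.obj)
    (hfib : ∀ c, Function.Surjective (K.fib c)) {H₁ H₂ : FA.Hom Z Y}
    (h : K.comp H₁ = K.comp H₂) : H₁ = H₂ := by
  have ho : H₁.o = H₂.o := functor_eq_of_comp_eq hobj (congrArg FA.Hom.o h)
  have hp := (FA.Hom.ext_iff.1 h).2
  obtain ⟨o₁, p₁, _, _, _, _⟩ := H₁
  obtain ⟨o₂, p₂, _, _, _, _⟩ := H₂
  obtain rfl : o₁ = o₂ := ho
  have hp := eq_of_heq hp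
  congr 1
  ext ⟨e⟩ r
  obtain ⟨c, rfl⟩ := hobj e
  obtain ⟨r, rfl⟩ := hfib c r
  exact ConcreteCategory.congr_hom (NatTrans.congr_app hp (op c)) r

/-- The hypothesis `hp` serves twice: with antisymmetry it makes the value independent of the lift,
even across fibres that `K` identifies, and within one fibre it gives monotonicity. Naturality uses
fullness to lift the reindexing morphism. -/
theorem exists_natTrans_fib_eq (hfull : K.o.Full) (hobj : Function.Surjective K.o.obj)
    (hfib : ∀ c, Function.Surjective (K.fib c)) {H : Z.C ⥤ Y.C} (p : X.P ⟶ (K.o ⋙ H).op ⋙ Y.P)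
    (hp : ∀ (c₁ c₂ : X.C) (r₁ : X.Fib c₁) (r₂ : X.Fib c₂),
      (⟨K.o.obj c₁, K.fib c₁ r₁⟩ : Σ e : Z.C, Z.Fib e) ≤ ⟨K.o.obj c₂, K.fib c₂ r₂⟩ →
      (⟨H.obj (K.o.obj c₁), p.app (op c₁) r₁⟩ : Σ d : Y.C, Y.Fib d) ≤
        ⟨H.obj (K.o.obj c₂), p.app (op c₂) r₂⟩) :
    ∃ p' : Z.P ⟶ H.op ⋙ Y.P, ∀ (c : X.C) (r : X.Fib c),
      (p'.app (op (K.o.obj c)) (K.fib c r) : Y.Fib (H.obj (K.o.obj c))) = p.app (op c) r := by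
  have h (e : Z.C) (r : Z.Fib e) : ∃ t : Y.Fib (H.obj e), ∀ (c : X.C) (r' : X.Fib c),
      (⟨K.o.obj c, K.fib c r'⟩ : Σ e : Z.C, Z.Fib e) = ⟨e, r⟩ →
      (⟨H.obj (K.o.obj c), p.app (op c) r'⟩ : Σ d : Y.C, Y.Fib d) = ⟨H.obj e, t⟩ := by
    obtain ⟨c, rfl⟩ := hobj e
    obtain ⟨r, rfl⟩ := hfib c r
    exact ⟨p.app (op c) r, fun c' r' h =>
      le_antisymm (hp _ _ _ _ h.le) (hp _ _ _ _ h.ge)⟩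
  choose t ht using h
  have ht' (c : X.C) (r : X.Fib c) : t (K.o.obj c) (K.fib c r) = p.app (op c) r :=
    (eq_of_heq (Sigma.mk.inj (ht _ _ c r rfl)).2).symm
  refine ⟨{ app := fun e => PartOrd.ofHom ⟨t e.unop, ?_⟩, naturality := ?_ }, ht'⟩
  · obtain ⟨e⟩ := e
    obtain ⟨c, rfl⟩ := hobj e
    intro r₁ r₂ h
    obtain ⟨r₁, rfl⟩ := hfib c r₁
    obtain ⟨r₂, rfl⟩ := hfib c r₂
    change t (K.o.obj c) _ ≤ t (K.o.obj c) _
    rw [ht', ht']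
    exact (Sigma.mk_le_mk_iff (α := fun d : Y.C => Y.Fib d)).1 (hp c c r₁ r₂ (Sigma.mk_le_mk_iff.2 h))
  · rintro ⟨e₁⟩ ⟨e₂⟩ ⟨g⟩
    change e₂ ⟶ e₁ at g
    obtain ⟨c₁, rfl⟩ := hobj e₁
    obtain ⟨c₂, rfl⟩ := hobj e₂
    obtain ⟨f, rfl⟩ := K.o.map_surjective g
    refine PartOrd.ext fun r => ?_
    obtain ⟨r, rfl⟩ := hfib c₁ r
    change t (K.o.obj c₂) (Z.pull (K.o.map f) (K.fib c₁ r)) =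
      Y.pull (H.map (K.o.map f)) (t (K.o.obj c₁) (K.fib c₁ r))
    rw [← fib_pull, ht', ht']
    exact ConcreteCategory.congr_hom (p.naturality f.op) r

/-- The comparison of `K ⋙ H` is the `H`-image of that of `K` followed by that of `H`, so the last
is invertible by two-out-of-three. Surjectivity on objects reaches every pair. -/
theorem preservesFiniteProducts_of_comp {C D E : Type*} [Category* C] [Category* D] [Category* E]
    [CartesianMonoidalCategory C] [CartesianMonoidalCategory D] [CartesianMonoidalCategory E]
    (K : C ⥤ E) (H : E ⥤ D) (hobj : Function.Surjective K.obj)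
    [Limits.PreservesFiniteProducts K] [Limits.PreservesFiniteProducts (K ⋙ H)] :
    Limits.PreservesFiniteProducts H := by
  have : IsIso (terminalComparison H) := by
    have h : H.map (terminalComparison K) ≫ terminalComparison H = terminalComparison (K ⋙ H) :=
      toUnit_unique _ _
    have : IsIso (H.map (terminalComparison K) ≫ terminalComparison H) :=
      h ▸ inferInstanceAs (IsIso (terminalComparison (K ⋙ H)))
    exact IsIso.of_isIso_comp_left (H.map (terminalComparison K)) _
  have (e₁ e₂ : E) : IsIso (prodComparison H e₁ e₂) := by
    obtain ⟨c₁, rfl⟩ := hobj e₁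
    obtain ⟨c₂, rfl⟩ := hobj e₂
    have : IsIso (H.map (prodComparison K c₁ c₂) ≫ prodComparison H (K.obj c₁) (K.obj c₂)) :=
      prodComparison_comp (F := K) (G := H) (A := c₁) (B := c₂) ▸
        inferInstanceAs (IsIso (prodComparison (K ⋙ H) c₁ c₂))
    exact IsIso.of_isIso_comp_left (H.map (prodComparison K c₁ c₂)) _
  exact preservesFiniteProducts_of_isIso_prodComparison H

theorem exists_comp_eq (hfull : K.o.Full) (hobj : Function.Surjective K.o.obj)
    (hfib : ∀ c, Function.Surjective (K.fib c)) (F : FA.Hom X Y) (hker : K.ker ≤ F.ker) :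
    ∃ H : FA.Hom Z Y, K.comp H = F := by
  obtain ⟨ho, hm, hf⟩ := hker
  obtain ⟨H, hH⟩ := exists_functor_comp_eq K.o F.o hobj ho hm
  obtain ⟨Fo, Fp, hpres, hconn, hquant, hEq⟩ := F
  obtain rfl : K.o ⋙ H = Fo := hH
  obtain ⟨p, hp⟩ := exists_natTrans_fib_eq hfull hobj hfib Fp
    fun c₁ c₂ r₁ r₂ h => hf ⟨c₁, r₁⟩ ⟨c₂, r₂⟩ h
  have hK := K.preserves
  have hHpres := preservesFiniteProducts_of_comp K.o H hobj
  have hnat {e₁ e₂ : Z.C} (g : e₁ ⟶ e₂) (r : Z.Fib e₂) :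
      (p.app (op e₁) (Z.pull g r) : Y.Fib (H.obj e₁)) = Y.pull (H.map g) (p.app (op e₂) r) :=
    ConcreteCategory.congr_hom (p.naturality g.op) r
  refine ⟨⟨H, p, hHpres, ?_, ?_, ?_⟩, ?_⟩
  · intro n k e r
    obtain ⟨c, rfl⟩ := hobj e
    choose r' hr' using fun i => hfib c (r i)
    obtain rfl := funext hr'
    rw [← fib_conn, hp]
    simp only [hp]
    exact hconn k c r'
  · intro q e₁ e₂ r
    obtain ⟨b, rfl⟩ := hobj e₁
    obtain ⟨c, rfl⟩ := hobj e₂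
    -- Surjectivity of `K` is available over the image of `b ⊗ c`, not over the product of the
    -- images, so `r` is first moved along the comparison.
    obtain ⟨r', hr'⟩ := hfib (b ⊗ c) (Z.pull (prodComparison K.o b c) r)
    obtain rfl : Z.pull (inv (prodComparison K.o b c)) (K.fib _ r') = r := by
      rw [hr', ← pull_comp, IsIso.inv_hom_id, pull_id]
    rw [← fib_quant, hp, hnat, hp, ← pull_comp]
    have h : inv (prodComparison (K.o ⋙ H) b c) =
        inv (prodComparison H (K.o.obj b) (K.o.obj c)) ≫
          H.map (inv (prodComparison K.o b c)) := by
      simp [prodComparison_comp]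
    rw [← h]
    exact hquant q b c r'
  · intro e
    obtain ⟨c, rfl⟩ := hobj e
    have h : Z.Eq (K.o.obj c) = Z.pull (inv (prodComparison K.o c c)) (K.fib _ (X.Eq c)) := by
      rw [fib_Eq, ← pull_comp, IsIso.inv_hom_id, pull_id]
    have h' : prodComparison H (K.o.obj c) (K.o.obj c) =
        H.map (inv (prodComparison K.o c c)) ≫ prodComparison (K.o ⋙ H) c c := by
      simp [prodComparison_comp]
    rw [h, hnat, hp, h', pull_comp]
    exact congrArg _ (hEq c)
  · have h : K.p ≫ Functor.whiskerLeft K.o.op p = Fp := by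
      ext ⟨c⟩ r
      exact hp c r
    subst h
    rfl

end FA.Hom
end FibUA

theorem mainTheorem4 (L : FibUA.FOLang.{l}) (Λ : FibUA.Logic.{l, s} L)
    (X Y : FibUA.FA.{l, u, v, w} L) (hX : X.IsModelOf Λ) (hY : Y.IsModelOf Λ) (F : X ⟶ Y) :
    (∃ (Z : FibUA.FA.{l, u, v, w} L) (ε : X ⟶ Z) (ψ : Z ⟶ Y),
      Z.IsModelOf Λ ∧ ε.IsQuotient ∧ ψ.IsSubprop ∧ ε ≫ ψ = F) ∧
    (∀ (Z : FibUA.FA.{l, u, v, w} L) (_ : Z.IsModelOf Λ) (K : X ⟶ Z),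
      K.o.Full → Function.Surjective K.o.obj → (∀ c : X.C, Function.Surjective (K.fib c)) →
        ((∃! H : Z ⟶ Y, K ≫ H = F) ↔ K.ker ≤ F.ker)) := by
  refine ⟨⟨F.image, F.toImage, F.imageInclusion, F.isSubprop_imageInclusion.isModelOf hY,
    F.isQuotient_toImage, F.isSubprop_imageInclusion, F.toImage_comp_imageInclusion⟩, ?_⟩
  intro Z _ K hfull hobj hfib
  constructor
  · rintro ⟨H, rfl, _⟩
    exact FibUA.FA.Hom.ker_le_ker_comp K H
  · intro hker
    obtain ⟨H, hH⟩ := FibUA.FA.Hom.exists_comp_eq hfull hobj hfib F hker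
    exact ⟨H, hH, fun H' hH' =>
      FibUA.FA.Hom.comp_left_cancel hfull hobj hfib (hH'.trans hH.symm)⟩
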